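/- For $z\in\mathbb{C}$ with $0<|z|<1$ let $f(x)=zx$ and $g(x)=z(x-1)+1$, let $\Lambda_z\subset\mathbb{C}$ be the limit set of the semigroup generated by $f$ and $g$ (the closure of the set of fixed points of its elements), and let $\mathcal{M}$ be the set of all such $z$ for which $\Lambda_z$ is connected. A finite word $u$ in the letters $f,g$ is also regarded as the corresponding composition of the maps $f$ and $g$ (the first letter is applied last), and $uX$ denotes the image of a set $X$ under it. Let $D\subset\mathbb{C}$ be a closed topological disk that contains $\Lambda_z$ in its interior. A pair of finite words $u,v$ is a trap for $(z,D)$ if (1) $u$ starts with $f$ and $v$ starts with $g$; (2) there are points $p^{\pm}\in u\Lambda_z\setminus vD$ and $q^{\pm}\in v\Lambda_z\setminus uD$, a path $\alpha\subseteq uD$ with endpoints $p^{\pm}$ and a path $\beta\subseteq vD$ with endpoints $q^{\pm}$, such that the algebraic intersection number of $\alpha$ and $\beta$ is nonzero; (3) for some $\epsilon>0$ such that the $\epsilon/2$-neighborhood of $\Lambda_z$ is contained in $D$, there are a point of $f\Lambda_z$ and a point of $g\Lambda_z$ at distance at most $\epsilon$ from each other. Proposition (Traps in $\mathcal{M}$).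 Let $0<|z|<1$ and let $u,v$ be a trap for $(z,D)$, for some closed topological disk $D$ containing $\Lambda_z$ in its interior. Then $z$ lies in the interior of $\mathcal{M}$. -/

import Mathlib

namespace IFSTraps

open Set Metric

/-! ### The semigroup `G_z`, its limit set, and the connectedness locus -/

/-- The two letters `f`, `g` of the alphabet. -/
inductive Letter
  | f
  | g

/-- The generators `f : x ↦ z x` and `g : x ↦ z (x - 1) + 1`. -/
def gen (z : ℂ) : Letter → ℂ → ℂ
  | Letter.f => fun x => z * x
  | Letter.g => fun x => z * (x - 1) + 1

/-- The map `x ↦ u(z, x)` of a finite word `u`: the composition of the generators, in the order in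
which they are written, so that `(a u)(z, x) = a(z, u(z, x))`. -/
def wordMap (z : ℂ) : List Letter → ℂ → ℂ
  | [] => id
  | a :: u => gen z a ∘ wordMap z u

/-- The limit set `Λ_z` of the semigroup `G_z` generated by `f` and `g`: the closure of the set of
fixed points of elements of `G_z`. -/
def limitSet (z : ℂ) : Set ℂ :=
  closure {x | ∃ u : List Letter, u ≠ [] ∧ wordMap z u x = x}

/-- The connectedness locus `M`: the parameters `z` with `0 < |z| < 1` whose limit set is
connected. -/
def connectednessLocus : Set ℂ :=
  {z | 0 < ‖z‖ ∧ ‖z‖ < 1 ∧ IsConnected (limitSet z)}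

/-! ### Algebraic intersection numbers of plane paths -/

/-- `n` is the winding number about `0` of the loop `γ`: the loop has a continuous logarithm `θ`
whose total increment is `2πi n`. -/
def IsWindingNumber {w : ℂ} (γ : Path w w) (n : ℤ) : Prop :=
  ∃ θ : C(unitInterval, ℂ), (∀ t, Complex.exp (θ t) = γ t) ∧
    θ 1 - θ 0 = n * (2 * Real.pi * Complex.I)

theorem IsWindingNumber.unique {w : ℂ} {γ : Path w w} {m n : ℤ}
    (hm : IsWindingNumber γ m) (hn : IsWindingNumber γ n) : m = n := by
  obtain ⟨θ, hθ, h1⟩ := hm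
  obtain ⟨η, hη, h2⟩ := hn
  have hpi : (2 * Real.pi * Complex.I : ℂ) ≠ 0 := Complex.two_pi_I_ne_zero
  obtain ⟨k, hk⟩ := Complex.exp_eq_exp_iff_exists_int.1 ((hθ 0).trans (hη 0).symm)
  have key : ∀ t, θ t = η t + k * (2 * Real.pi * Complex.I) := by
    let η' : C(unitInterval, ℂ) := η + ContinuousMap.const _ (k * (2 * Real.pi * Complex.I))
    have hγ : ∀ t, γ t ≠ 0 := fun t => hθ t ▸ Complex.exp_ne_zero _
    have := Complex.isCoveringMap_exp.eq_of_comp_eq (g₁ := θ) (g₂ := η') θ.continuous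
      η'.continuous (by
        funext t
        apply Subtype.ext
        change Complex.exp (θ t) = Complex.exp (η t + k * (2 * Real.pi * Complex.I))
        rw [hθ, Complex.exp_add, Complex.exp_int_mul_two_pi_mul_I, mul_one, hη]) 0 hk
    exact fun t => congrFun this t
  have h3 : (m : ℂ) * (2 * Real.pi * Complex.I) = n * (2 * Real.pi * Complex.I) := by
    rw [← h1, ← h2, key 0, key 1]; ring
  exact_mod_cast mul_right_cancel₀ hpi h3

theorem exists_isWindingNumber {w : ℂ} (γ : Path w w) (hγ : ∀ t, γ t ≠ 0) :
    ∃ n, IsWindingNumber γ n := by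
  let γ' : C(unitInterval, {z : ℂ // z ≠ 0}) :=
    ⟨fun t => ⟨γ t, hγ t⟩, by fun_prop⟩
  have hw : w ≠ 0 := by simpa using hγ 0
  obtain ⟨θ, hθ, -⟩ := Complex.isCoveringMap_exp.exists_path_lifts γ' (Complex.log w) (by
    apply Subtype.ext
    change γ 0 = Complex.exp (Complex.log w)
    rw [Complex.exp_log hw, γ.source])
  have hθ' : ∀ t, Complex.exp (θ t) = γ t := fun t => congrArg Subtype.val (congrFun hθ t)
  obtain ⟨n, hn⟩ := Complex.exp_eq_exp_iff_exists_int.1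
    (show Complex.exp (θ 1) = Complex.exp (θ 0) by rw [hθ', hθ', γ.source, γ.target])
  exact ⟨n, θ, hθ', by rw [hn]; ring⟩

open Classical in
/-- The winding number about `0` of a loop in `ℂ` that avoids `0`
(and, by convention, `0` for a loop through `0`). -/
noncomputable def windingNumber {w : ℂ} (γ : Path w w) : ℤ :=
  if h : ∃ n, IsWindingNumber γ n then h.choose else 0

theorem isWindingNumber_windingNumber {w : ℂ} (γ : Path w w) (hγ : ∀ t, γ t ≠ 0) :
    IsWindingNumber γ (windingNumber γ) := by
  have h := exists_isWindingNumber γ hγ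
  rw [windingNumber, dif_pos h]
  exact h.choose_spec

/-- The restriction of `(s, t) ↦ α s - β t` to the boundary of the unit square, traversed through
the corners `(0,0)`, `(0,1)`, `(1,1)`, `(1,0)`, `(0,0)` in this order. -/
noncomputable def differenceLoop {p p' q q' : ℂ} (α : Path p p') (β : Path q q') : Path (p - q) (p - q) :=
  (((β.map (f := fun y => p - y) (by fun_prop)).trans
    (α.map (f := fun x => x - q') (by fun_prop))).trans
    (β.map (f := fun y => p' - y) (by fun_prop)).symm).trans
    (α.map (f := fun x => x - q) (by fun_prop)).symm

/-- The algebraic intersection number `α · β` of two paths in the oriented plane such that no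
endpoint of either path lies on the other one: the degree over `0` of the map
`(s, t) ↦ α s - β t` of the unit square, that is, the winding number about `0` of its restriction
to the boundary. The direction in which the boundary is traversed is such that a transverse
crossing counts `+1` if the tangent vectors of `α` and `β` form a positively oriented basis, and
`-1` otherwise; for paths in general position this is the signed number of crossings. -/
noncomputable def algebraicIntersectionNumber {p p' q q' : ℂ} (α : Path p p') (β : Path q q') : ℤ :=
  windingNumber (differenceLoop α β)

/-! ### Traps -/

/-- A closed topological disk in the plane. -/
def IsClosedTopologicalDisk (D : Set ℂ) : Prop :=
  Nonempty (D ≃ₜ closedBall (0 : ℂ) 1)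

/-- The pair of finite words `u`, `v` is a trap for `(z, D)`. -/
structure IsTrap (z : ℂ) (D : Set ℂ) (u v : List Letter) : Prop where
  isDisk : IsClosedTopologicalDisk D
  limitSet_subset : limitSet z ⊆ interior D
  /-- `u` starts with `f`. -/
  left_start : ∃ u', u = Letter.f :: u'
  /-- `v` starts with `g`. -/
  right_start : ∃ v', v = Letter.g :: v'
  /-- There are points `p⁺, p⁻ ∈ uΛ_z - vD` and `q⁺, q⁻ ∈ vΛ_z - uD`, a path `α` in `uD` between
  `p⁻` and `p⁺` and a path `β` in `vD` between `q⁻` and `q⁺`, whose algebraic intersection number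
  is nonzero. -/
  crossing : ∃ pm ∈ (wordMap z u '' limitSet z) \ (wordMap z v '' D),
    ∃ pp ∈ (wordMap z u '' limitSet z) \ (wordMap z v '' D),
    ∃ qm ∈ (wordMap z v '' limitSet z) \ (wordMap z u '' D),
    ∃ qp ∈ (wordMap z v '' limitSet z) \ (wordMap z u '' D),
    ∃ (α : Path pm pp) (β : Path qm qp),
      range α ⊆ wordMap z u '' D ∧ range β ⊆ wordMap z v '' D ∧
        algebraicIntersectionNumber α β ≠ 0
  /-- There are points of `fΛ_z` and `gΛ_z` within distance `ε` of each other, where the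
  `ε/2`-neighborhood of `Λ_z` is contained in `D`. -/
  close : ∃ ε : ℝ, 0 < ε ∧ thickening (ε / 2) (limitSet z) ⊆ D ∧
    ∃ x ∈ gen z Letter.f '' limitSet z, ∃ y ∈ gen z Letter.g '' limitSet z, dist x y ≤ ε

end IFSTraps

namespace IFSTraps

open Set Metric Filter Topology unitInterval

/-! ### The limit set -/

/-! The limit set is connected once `fΛ` meets `gΛ` (`isConnected_limitSet`), so it suffices to
force a meeting for all parameters near `z`. Suppose `fΛ` and `gΛ` have distance `δ > 0`. Any two
points of `Λ` are joined by a path in the closed `δ/2`-neighborhood of `Λ`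
(`joinedIn_cthickening_half`). If that neighborhood lies in `D`, apply `u` and `v` to such paths
with the endpoints prescribed by the trap: the images must cross, since the intersection number
survives deformation inside `uD` and `vD` (`IsTrap.exists_crossing`). The crossing point is within
`‖z‖ * δ / 2` of both `fΛ` and `gΛ`, which puts these sets closer than `δ`, a contradiction
(`gen_image_inter_nonempty`). The argument runs twice. At `z` itself the trap's `ε` gives a common
point. At nearby parameters, semicontinuity of `Λ` then keeps `fΛ` and `gΛ` close, and the crossing
property is stable. -/

theorem gen_sub (z : ℂ) (a : Letter) (x y : ℂ) : gen z a x - gen z a y = z * (x - y) := by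
  cases a <;> simp only [gen] <;> ring

theorem dist_gen (z : ℂ) (a : Letter) (x y : ℂ) :
    dist (gen z a x) (gen z a y) = ‖z‖ * dist x y := by
  rw [dist_eq_norm, gen_sub, norm_mul, dist_eq_norm]

theorem continuous_gen (a : Letter) : Continuous fun p : ℂ × ℂ => gen p.1 a p.2 := by
  cases a <;> simp only [gen] <;> fun_prop

theorem wordMap_append (z : ℂ) (u v : List Letter) (x : ℂ) :
    wordMap z (u ++ v) x = wordMap z u (wordMap z v x) := by
  induction u with
  | nil => rfl
  | cons a u ih => exact congrArg (gen z a) ih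

theorem wordMap_sub (z : ℂ) (u : List Letter) (x y : ℂ) :
    wordMap z u x - wordMap z u y = z ^ u.length * (x - y) := by
  induction u with
  | nil => simp [wordMap]
  | cons a u ih =>
    change gen z a (wordMap z u x) - gen z a (wordMap z u y) = _
    rw [gen_sub, ih, List.length_cons]
    ring

theorem dist_wordMap (z : ℂ) (u : List Letter) (x y : ℂ) :
    dist (wordMap z u x) (wordMap z u y) = ‖z‖ ^ u.length * dist x y := by
  rw [dist_eq_norm, wordMap_sub, norm_mul, norm_pow, dist_eq_norm]

theorem continuous_wordMap (u : List Letter) :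
    Continuous fun p : ℂ × ℂ => wordMap p.1 u p.2 := by
  induction u with
  | nil => exact continuous_snd
  | cons a u ih => exact (continuous_gen a).comp (continuous_fst.prodMk ih)

theorem wordMap_eq (z : ℂ) (u : List Letter) (x : ℂ) :
    wordMap z u x = z ^ u.length * x + wordMap z u 0 := by
  linear_combination wordMap_sub z u x 0

theorem pow_ne_one_of_norm_lt {z : ℂ} (hz : ‖z‖ < 1) {n : ℕ} (hn : n ≠ 0) : 1 - z ^ n ≠ 0 := by
  intro h
  have : ‖z‖ ^ n = 1 := by rw [← norm_pow, ← sub_eq_zero.1 h, norm_one]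
  exact (pow_lt_one₀ (norm_nonneg z) hz hn).ne this

theorem exists_long_word_fixing {z x : ℂ} {w : List Letter} (hw : w ≠ [])
    (hx : wordMap z w x = x) (k : ℕ) : ∃ W : List Letter, k ≤ W.length ∧ wordMap z W x = x := by
  induction k with
  | zero => exact ⟨[], le_rfl, rfl⟩
  | succ k ih =>
    obtain ⟨W, hk, hW⟩ := ih
    refine ⟨w ++ W, ?_, by rw [wordMap_append, hW, hx]⟩
    have := List.length_pos_iff.2 hw
    rw [List.length_append]
    omega

theorem tendsto_pow_length {z : ℂ} (hz : ‖z‖ < 1) {W : ℕ → List Letter}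
    (hW : ∀ k, k ≤ (W k).length) : Tendsto (fun k => z ^ (W k).length) atTop (𝓝 0) :=
  (tendsto_pow_atTop_nhds_zero_of_norm_lt_one hz).comp (tendsto_atTop_mono hW tendsto_id)

theorem wordMap_mem {z : ℂ} {N : Set ℂ} (h : ∀ a, ∀ x ∈ N, gen z a x ∈ N) (u : List Letter)
    {x : ℂ} (hx : x ∈ N) : wordMap z u x ∈ N := by
  induction u with
  | nil => exact hx
  | cons a u ih => exact h a _ ih

/-- Iterating a contracting word from any point of `N` converges to its fixed point without leaving
`N`. -/
theorem limitSet_subset_of_forward_invariant {z : ℂ} (hz : ‖z‖ < 1) {N : Set ℂ}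
    (hN : IsClosed N) (hne : N.Nonempty) (h : ∀ a, ∀ x ∈ N, gen z a x ∈ N) :
    limitSet z ⊆ N := by
  refine closure_minimal ?_ hN
  rintro x ⟨w, hw, hx⟩
  obtain ⟨y, hy⟩ := hne
  choose W hk hW using exists_long_word_fixing hw hx
  have hlim : Tendsto (fun k => wordMap z (W k) y) atTop (𝓝 x) := by
    have : Tendsto (fun k => x + z ^ (W k).length * (y - x)) atTop (𝓝 (x + 0 * (y - x))) :=
      ((tendsto_pow_length hz hk).mul_const _).const_add _
    rw [zero_mul, add_zero] at this
    refine this.congr fun k => ?_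
    linear_combination -wordMap_sub z (W k) y x - hW k
  exact hN.mem_of_tendsto hlim (Eventually.of_forall fun k => wordMap_mem h _ hy)

theorem gen_mem_limitSet {z : ℂ} (hz : ‖z‖ < 1) (a : Letter) {x : ℂ} (hx : x ∈ limitSet z) :
    gen z a x ∈ limitSet z := by
  have hcont : Continuous (gen z a) := (continuous_gen a).comp (continuous_const.prodMk continuous_id)
  have hmaps : MapsTo (gen z a) {x | ∃ u : List Letter, u ≠ [] ∧ wordMap z u x = x}
      (limitSet z) := by
    rintro x ⟨w, hw, hx⟩
    choose W hk hW using exists_long_word_fixing hw hx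
    have hne : ∀ k, 1 - z ^ (a :: W k).length ≠ 0 := fun k =>
      pow_ne_one_of_norm_lt hz (by simp)
    have hlen : Tendsto (fun k => z ^ (a :: W k).length) atTop (𝓝 0) :=
      tendsto_pow_length hz fun k => (hk k).trans (by simp)
    -- These quotients are the fixed points of the words `a :: W k`, which send `x` to `gen z a x`
    -- with contraction ratio tending to `0`.
    have hlim : Tendsto (fun k => (gen z a x - z ^ (a :: W k).length * x) /
        (1 - z ^ (a :: W k).length)) atTop (𝓝 (gen z a x)) := by
      have := ((tendsto_const_nhds (x := gen z a x)).sub (hlen.mul_const x)).div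
        ((tendsto_const_nhds (x := (1 : ℂ))).sub hlen) (by simp)
      rwa [zero_mul, sub_zero, sub_zero, div_one] at this
    refine isClosed_closure.mem_of_tendsto hlim (Eventually.of_forall fun k => subset_closure ?_)
    refine ⟨a :: W k, by simp, ?_⟩
    have h0 : wordMap z (a :: W k) x = gen z a x := congrArg (gen z a) (hW k)
    have h1 := wordMap_sub z (a :: W k) ((gen z a x - z ^ (a :: W k).length * x) /
        (1 - z ^ (a :: W k).length)) x
    have h2 := div_mul_cancel₀ (gen z a x - z ^ (a :: W k).length * x) (hne k)
    linear_combination h1 + h0 - h2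
  exact (closure_minimal hmaps (isClosed_closure.preimage hcont)) hx

theorem zero_mem_limitSet (z : ℂ) : (0 : ℂ) ∈ limitSet z :=
  subset_closure ⟨[Letter.f], by simp, by simp [wordMap, gen]⟩

theorem isCompact_limitSet {z : ℂ} (hz : ‖z‖ < 1) : IsCompact (limitSet z) := by
  have hpos : 0 < 1 - ‖z‖ := sub_pos.2 hz
  refine (isCompact_closedBall (0 : ℂ) (‖1 - z‖ / (1 - ‖z‖))).of_isClosed_subset
    isClosed_closure (limitSet_subset_of_forward_invariant hz isClosed_closedBall
      ⟨0, mem_closedBall_self (by positivity)⟩ fun a x hx => ?_)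
  rw [mem_closedBall_zero_iff] at hx ⊢
  -- The radius is the solution of `‖z‖ * R + ‖1 - z‖ = R`, so both generators preserve the ball.
  have hR : ‖z‖ * (‖1 - z‖ / (1 - ‖z‖)) + ‖1 - z‖ = ‖1 - z‖ / (1 - ‖z‖) := by
    field_simp
    ring
  have hzx : ‖z * x‖ ≤ ‖z‖ * (‖1 - z‖ / (1 - ‖z‖)) := by
    rw [norm_mul]
    gcongr
  rw [← hR]
  cases a with
  | f => exact hzx.trans (le_add_of_nonneg_right (norm_nonneg _))
  | g =>
    rw [show gen z Letter.g x = z * x + (1 - z) by simp only [gen]; ring]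
    exact (norm_add_le _ _).trans (add_le_add_left hzx _)

theorem isCompact_gen_image_limitSet {z : ℂ} (hz : ‖z‖ < 1) (a : Letter) :
    IsCompact (gen z a '' limitSet z) :=
  (isCompact_limitSet hz).image ((continuous_gen a).comp (continuous_const.prodMk continuous_id))

theorem exists_gen_eq_of_mem_limitSet {z : ℂ} (hz : ‖z‖ < 1) {x : ℂ} (hx : x ∈ limitSet z) :
    ∃ a, ∃ y ∈ limitSet z, gen z a y = x := by
  have hsub : limitSet z ⊆ gen z Letter.f '' limitSet z ∪ gen z Letter.g '' limitSet z := by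
    refine closure_minimal ?_ ((isCompact_gen_image_limitSet hz _).isClosed.union
      (isCompact_gen_image_limitSet hz _).isClosed)
    rintro x ⟨w, hw, hx⟩
    match w, hw with
    | a :: w, _ =>
      have hy : wordMap z w x ∈ limitSet z := by
        -- Cyclic rotation: if `a :: w` fixes `x`, then `w ++ [a]` fixes the image of `x` under `w`.
        refine subset_closure ⟨w ++ [a], by simp, ?_⟩
        rw [wordMap_append]
        exact congrArg (wordMap z w) hx
      cases a with
      | f => exact Or.inl ⟨_, hy, hx⟩
      | g => exact Or.inr ⟨_, hy, hx⟩
  rcases hsub hx with ⟨y, hy, h⟩ | ⟨y, hy, h⟩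
  exacts [⟨_, y, hy, h⟩, ⟨_, y, hy, h⟩]

/-- The limit set is lower semicontinuous in the parameter. -/
theorem eventually_exists_dist_limitSet_lt {z : ℂ} (hz : ‖z‖ < 1) {x : ℂ} (hx : x ∈ limitSet z)
    {ρ : ℝ} (hρ : 0 < ρ) : ∀ᶠ z' in 𝓝 z, ∃ x' ∈ limitSet z', dist x' x < ρ := by
  obtain ⟨y, ⟨w, hw, hy⟩, hxy⟩ := mem_closure_iff.1 hx (ρ / 2) (half_pos hρ)
  have hlen : w.length ≠ 0 := fun h => hw (List.length_eq_zero_iff.1 h)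
  have hne := pow_ne_one_of_norm_lt hz hlen
  have hcw : Continuous fun z' => wordMap z' w 0 :=
    (continuous_wordMap w).comp (continuous_id.prodMk continuous_const)
  -- The fixed point of a given word is an explicit continuous function of the parameter.
  have hfix : wordMap z w 0 / (1 - z ^ w.length) = y := by
    rw [div_eq_iff hne]
    linear_combination hy - wordMap_eq z w y
  have hcont : ContinuousAt (fun z' => wordMap z' w 0 / (1 - z' ^ w.length)) z :=
    hcw.continuousAt.div (by fun_prop) hne
  have hnear : ∀ᶠ z' in 𝓝 z, dist (wordMap z' w 0 / (1 - z' ^ w.length)) y < ρ / 2 := by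
    rw [← hfix]
    exact hcont.eventually (ball_mem_nhds _ (half_pos hρ))
  have hlt : ∀ᶠ z' : ℂ in 𝓝 z, ‖z'‖ < 1 := continuous_norm.continuousAt.eventually_lt_const hz
  filter_upwards [hnear, hlt] with z' h1 h2
  refine ⟨_, subset_closure ⟨w, hw, ?_⟩, (dist_triangle_right _ _ y).trans_lt
    ((add_lt_add h1 hxy).trans_eq (add_halves ρ))⟩
  rw [wordMap_eq]
  have := pow_ne_one_of_norm_lt h2 hlen
  field_simp
  ring

/-- The limit set is upper semicontinuous in the parameter. -/
theorem eventually_limitSet_subset_cthickening {z : ℂ} (hz : ‖z‖ < 1) {η : ℝ} (hη : 0 < η) :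
    ∀ᶠ z' in 𝓝 z, limitSet z' ⊆ cthickening η (limitSet z) := by
  have hc := isCompact_limitSet hz
  -- Contraction sends the compact `η`-neighborhood into the open one, so by compactness this
  -- persists for nearby `z'` and gives forward invariance.
  have key : ∀ a, ∀ᶠ z' in 𝓝 z, ∀ x ∈ cthickening η (limitSet z),
      gen z' a x ∈ thickening η (limitSet z) := fun a => by
    refine hc.cthickening.eventually_forall_of_forall_eventually fun x hx => ?_
    refine (continuous_gen a).continuousAt.eventually (isOpen_thickening.mem_nhds ?_)
    rw [hc.cthickening_eq_biUnion_closedBall hη.le] at hx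
    obtain ⟨y, hy, hxy⟩ := mem_iUnion₂.1 hx
    refine mem_thickening_iff.2 ⟨_, gen_mem_limitSet hz a hy, ?_⟩
    rw [dist_gen]
    calc ‖z‖ * dist x y ≤ ‖z‖ * η := by gcongr; exact hxy
      _ < η := mul_lt_of_lt_one_left hη hz
  have hlt : ∀ᶠ z' : ℂ in 𝓝 z, ‖z'‖ < 1 := continuous_norm.continuousAt.eventually_lt_const hz
  filter_upwards [key Letter.f, key Letter.g, hlt] with z' hf hg h1
  refine limitSet_subset_of_forward_invariant h1 isClosed_cthickening
    ⟨0, self_subset_cthickening _ (zero_mem_limitSet z)⟩ fun a x hx => ?_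
  cases a with
  | f => exact thickening_subset_cthickening _ _ (hf x hx)
  | g => exact thickening_subset_cthickening _ _ (hg x hx)

/-! ### Paths near the limit set -/

theorem exists_dist_le_of_mem_cthickening {z : ℂ} (hz : ‖z‖ < 1) {r : ℝ} (hr : 0 ≤ r) {w : ℂ}
    (hw : w ∈ cthickening r (limitSet z)) : ∃ x ∈ limitSet z, dist w x ≤ r := by
  rw [(isCompact_limitSet hz).cthickening_eq_biUnion_closedBall hr] at hw
  obtain ⟨x, hx, hwx⟩ := mem_iUnion₂.1 hw
  exact ⟨x, hx, hwx⟩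

theorem joinedIn_cthickening_of_dist_le {Λ : Set ℂ} {x y : ℂ} (hx : x ∈ Λ) (hy : y ∈ Λ) {r : ℝ}
    (h : dist x y ≤ r) : JoinedIn (cthickening (r / 2) Λ) x y := by
  refine JoinedIn.of_segment_subset fun w hw => ?_
  have hadd := dist_add_dist_of_mem_segment hw
  rcases le_total (dist x w) (dist w y) with hle | hle
  · exact mem_cthickening_of_dist_le w x _ _ hx (by rw [dist_comm]; linarith)
  · exact mem_cthickening_of_dist_le w y _ _ hy (by linarith)

/-- Self-similarity: a generator maps a path near `Λ` to one nearer by the factor `‖z‖`, and the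
segment from `p` to `q` bridges the two pieces. Only the bridge, of width `δ`, does not shrink with
`n`. -/
theorem joinedIn_cthickening {z : ℂ} (hz : ‖z‖ < 1) {δ C : ℝ} {p q : ℂ} (hδ : 0 ≤ δ)
    (hp : p ∈ gen z Letter.f '' limitSet z) (hq : q ∈ gen z Letter.g '' limitSet z)
    (hpq : dist p q ≤ δ) (hC : ∀ x ∈ limitSet z, ∀ y ∈ limitSet z, dist x y ≤ C) (n : ℕ) :
    ∀ x ∈ limitSet z, ∀ y ∈ limitSet z,
      JoinedIn (cthickening (max δ (‖z‖ ^ n * C) / 2) (limitSet z)) x y := by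
  induction n with
  | zero =>
    intro x hx y hy
    refine joinedIn_cthickening_of_dist_le hx hy ((hC x hx y hy).trans ?_)
    simp
  | succ n ih =>
    have hle : ‖z‖ * max δ (‖z‖ ^ n * C) ≤ max δ (‖z‖ ^ (n + 1) * C) := by
      rw [mul_max_of_nonneg _ _ (norm_nonneg z), ← mul_assoc, ← pow_succ']
      exact max_le_max_right _ (mul_le_of_le_one_left hδ hz.le)
    have himage : ∀ a, ∀ x ∈ limitSet z, ∀ y ∈ limitSet z,
        JoinedIn (cthickening (max δ (‖z‖ ^ (n + 1) * C) / 2) (limitSet z))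
          (gen z a x) (gen z a y) := by
      intro a x hx y hy
      refine ((ih x hx y hy).map ((continuous_gen a).comp
        (continuous_const.prodMk continuous_id))).mono ?_
      rintro _ ⟨w, hw, rfl⟩
      obtain ⟨b, hb, hwb⟩ := exists_dist_le_of_mem_cthickening hz
        (div_nonneg (hδ.trans (le_max_left _ _)) two_pos.le) hw
      refine mem_cthickening_of_dist_le _ _ _ _ (gen_mem_limitSet hz a hb) ?_
      change dist (gen z a w) (gen z a b) ≤ _
      rw [dist_gen]
      calc ‖z‖ * dist w b ≤ ‖z‖ * (max δ (‖z‖ ^ n * C) / 2) := by gcongr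
        _ ≤ _ := by linarith
    obtain ⟨p, hp, rfl⟩ := hp
    obtain ⟨q, hq, rfl⟩ := hq
    have hhop : JoinedIn (cthickening (max δ (‖z‖ ^ (n + 1) * C) / 2) (limitSet z))
        (gen z Letter.f p) (gen z Letter.g q) :=
      joinedIn_cthickening_of_dist_le (gen_mem_limitSet hz _ hp) (gen_mem_limitSet hz _ hq)
        (hpq.trans (le_max_left _ _))
    intro x hx y hy
    obtain ⟨a, x, hx', rfl⟩ := exists_gen_eq_of_mem_limitSet hz hx
    obtain ⟨b, y, hy', rfl⟩ := exists_gen_eq_of_mem_limitSet hz hy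
    cases a <;> cases b
    · exact himage _ x hx' y hy'
    · exact ((himage _ x hx' p hp).trans hhop).trans (himage _ q hq y hy')
    · exact ((himage _ x hx' q hq).trans hhop.symm).trans (himage _ p hp y hy')
    · exact himage _ x hx' y hy'

theorem exists_dist_limitSet_le {z : ℂ} (hz : ‖z‖ < 1) :
    ∃ C, ∀ x ∈ limitSet z, ∀ y ∈ limitSet z, dist x y ≤ C :=
  isBounded_iff.1 (isCompact_limitSet hz).isBounded |>.imp fun _ h _ hx _ hy => h hx hy

theorem exists_pow_norm_mul_lt {z : ℂ} (hz : ‖z‖ < 1) (C : ℝ) {ε : ℝ} (hε : 0 < ε) :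
    ∃ n : ℕ, ‖z‖ ^ n * C < ε := by
  have := (tendsto_pow_atTop_nhds_zero_of_lt_one (norm_nonneg z) hz).mul_const C
  rw [zero_mul] at this
  exact (this.eventually_lt_const hε).exists

/-- If the distance of `fΛ_z` and `gΛ_z` is at most `δ`, then any two points of `Λ_z` are joined
by a path in the closed `δ/2`-neighbourhood of `Λ_z`. -/
theorem joinedIn_cthickening_half {z : ℂ} (hz : ‖z‖ < 1) {δ : ℝ} {p q : ℂ} (hδ : 0 < δ)
    (hp : p ∈ gen z Letter.f '' limitSet z) (hq : q ∈ gen z Letter.g '' limitSet z)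
    (hpq : dist p q ≤ δ) {x y : ℂ} (hx : x ∈ limitSet z) (hy : y ∈ limitSet z) :
    JoinedIn (cthickening (δ / 2) (limitSet z)) x y := by
  obtain ⟨C, hC⟩ := exists_dist_limitSet_le hz
  obtain ⟨n, hn⟩ := exists_pow_norm_mul_lt hz C hδ
  have := joinedIn_cthickening hz hδ.le hp hq hpq hC n x hx y hy
  rwa [max_eq_left hn.le] at this

/-- A common point allows hops of every size `r > 0`, while a separation of the compact set `Λ`
would leave a gap that short hops cannot cross. -/
theorem isConnected_limitSet {z : ℂ} (hz : ‖z‖ < 1) {p : ℂ}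
    (hf : p ∈ gen z Letter.f '' limitSet z) (hg : p ∈ gen z Letter.g '' limitSet z) :
    IsConnected (limitSet z) := by
  have hc := isCompact_limitSet hz
  refine ⟨⟨0, zero_mem_limitSet z⟩, isPreconnected_closed_iff.2 ?_⟩
  rintro A B hA hB hAB ⟨x, hx, hxA⟩ ⟨y, hy, hyB⟩
  by_contra hempty
  have hdisj : Disjoint (limitSet z ∩ A) (limitSet z ∩ B) :=
    disjoint_left.2 fun w hw hw' => hempty ⟨w, hw.1, hw.2, hw'.2⟩
  obtain ⟨r, hr, hthick⟩ := hdisj.exists_thickenings (hc.inter_right hA) (hc.isClosed.inter hB)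
  obtain ⟨γ, hγ⟩ := joinedIn_cthickening_half hz hr hf hg (by rw [dist_self]; exact hr.le) hx hy
  have hcover : range γ ⊆ thickening r (limitSet z ∩ A) ∪ thickening r (limitSet z ∩ B) := by
    rintro _ ⟨t, rfl⟩
    obtain ⟨b, hb, hdist⟩ := exists_dist_le_of_mem_cthickening hz (half_pos hr).le (hγ t)
    have hlt := hdist.trans_lt (half_lt_self hr)
    rcases hAB hb with h | h
    · exact Or.inl (mem_thickening_iff.2 ⟨b, ⟨hb, h⟩, hlt⟩)
    · exact Or.inr (mem_thickening_iff.2 ⟨b, ⟨hb, h⟩, hlt⟩)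
  obtain ⟨w, -, hwA, hwB⟩ := isPreconnected_range γ.continuous _ _ isOpen_thickening
    isOpen_thickening hcover
    ⟨x, ⟨0, γ.source⟩, self_subset_thickening hr _ ⟨hx, hxA⟩⟩
    ⟨y, ⟨1, γ.target⟩, self_subset_thickening hr _ ⟨hy, hyB⟩⟩
  exact disjoint_left.1 hthick hwA hwB

/-! ### Vanishing of intersection numbers -/

theorem log_sub_log_eq {X : Type*} [TopologicalSpace X] [PreconnectedSpace X] (θ η : C(X, ℂ))
    (h : ∀ x, Complex.exp (θ x) = Complex.exp (η x)) (x y : X) :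
    θ x - θ y = η x - η y := by
  obtain ⟨k, hk⟩ := Complex.exp_eq_exp_iff_exists_int.1 (h y)
  have := Complex.isCoveringMap_exp.eq_of_comp_eq θ.continuous
    (η.continuous.add (continuous_const (y := k * (2 * Real.pi * Complex.I)))) (by
      funext t
      apply Subtype.ext
      change Complex.exp (θ t) = Complex.exp (η t + k * (2 * Real.pi * Complex.I))
      rw [h, Complex.exp_add, Complex.exp_int_mul_two_pi_mul_I, mul_one]) y hk
  have hx : θ x = η x + k * (2 * Real.pi * Complex.I) := congrFun this x
  rw [hx, hk]
  ring

theorem exists_log_path (γ : C(I, ℂ)) (hγ : ∀ t, γ t ≠ 0) :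
    ∃ θ : C(I, ℂ), ∀ t, Complex.exp (θ t) = γ t := by
  let γ' : C(I, {z : ℂ // z ≠ 0}) := ⟨fun t => ⟨γ t, hγ t⟩, by fun_prop⟩
  obtain ⟨θ, hθ, -⟩ := Complex.isCoveringMap_exp.exists_path_lifts γ' (Complex.log (γ 0))
    (Subtype.ext (Complex.exp_log (hγ 0)).symm)
  exact ⟨θ, fun t => congrArg Subtype.val (congrFun hθ t)⟩

theorem exists_log_square (H : C(I × I, ℂ)) (hH : ∀ p, H p ≠ 0) :
    ∃ Θ : C(I × I, ℂ), ∀ p, Complex.exp (Θ p) = H p := by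
  let H' : C(I × I, {z : ℂ // z ≠ 0}) := ⟨fun p => ⟨H p, hH p⟩, by fun_prop⟩
  obtain ⟨θ, hθ⟩ := exists_log_path ⟨fun t => H (0, t), by fun_prop⟩ fun t => hH _
  exact ⟨Complex.isCoveringMap_exp.liftHomotopy H' θ fun t => Subtype.ext (hθ t).symm, fun p =>
    congrArg Subtype.val (congrFun (Complex.isCoveringMap_exp.liftHomotopy_lifts H' θ _) p)⟩

/-- `differenceLoop α β` is `(s, t) ↦ α s - β t` along a loop in the boundary of the unit square. -/
theorem exists_differenceLoop_eq : ∃ S T : C(I, I),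
    (∀ r, S r = 0 ∨ S r = 1 ∨ T r = 0 ∨ T r = 1) ∧ S 0 = S 1 ∧ T 0 = T 1 ∧
      ∀ {p p' q q' : ℂ} (α : Path p p') (β : Path q q') (r : I),
        differenceLoop α β r = α (S r) - β (T r) := by
  let ι : Path (0 : I) 1 := ⟨ContinuousMap.id I, rfl, rfl⟩
  refine ⟨((((Path.refl 0).trans ι).trans (Path.refl 1)).trans ι.symm),
    (((ι.trans (Path.refl 1)).trans ι.symm).trans (Path.refl 0)), fun r => ?_, by simp, by simp,
    fun α β r => ?_⟩
  · simp only [ContinuousMap.coe_coe, Path.trans_apply]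
    split_ifs <;> simp
  · simp only [ContinuousMap.coe_coe, Path.trans_apply, differenceLoop]
    split_ifs <;> simp [Path.symm_apply] <;> rfl

/-- The intersection number of two paths vanishes if they can be deformed to disjoint paths in such
a way that the endpoints of either path stay off the other one. -/
theorem algebraicIntersectionNumber_eq_zero {p p' q q' : ℂ} {α : Path p p'} {β : Path q q'}
    (A B : C(I × I, ℂ)) (hA : ∀ s, A (0, s) = α s) (hB : ∀ t, B (0, t) = β t)
    (hbd : ∀ τ s t, (s = 0 ∨ s = 1 ∨ t = 0 ∨ t = 1) → A (τ, s) ≠ B (τ, t))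
    (hdisj : ∀ s t, A (1, s) ≠ B (1, t)) : algebraicIntersectionNumber α β = 0 := by
  obtain ⟨S, T, hST, hS, hT, hloop⟩ := exists_differenceLoop_eq
  obtain ⟨Θ, hΘ⟩ := exists_log_square
    ⟨fun x => A (x.1, S x.2) - B (x.1, T x.2), by fun_prop⟩
    fun x => sub_ne_zero.2 (hbd _ _ _ (hST x.2))
  obtain ⟨Φ, hΦ⟩ := exists_log_square ⟨fun x => A (1, x.1) - B (1, x.2), by fun_prop⟩
    fun x => sub_ne_zero.2 (hdisj _ _)
  simp only [ContinuousMap.coe_mk] at hΘ hΦ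
  have h0 : ∀ r, differenceLoop α β r = Complex.exp (Θ (0, r)) := fun r => by
    rw [hloop, hΘ, hA, hB]
  -- Both sides of the homotopy carry logarithms of the same function, so the increment around the
  -- loop is the same at `τ = 0` and `τ = 1`.
  have hends : Θ (0, 1) - Θ (1, 1) = Θ (0, 0) - Θ (1, 0) :=
    log_sub_log_eq ⟨fun τ => Θ (τ, 1), by fun_prop⟩ ⟨fun τ => Θ (τ, 0), by fun_prop⟩
      (fun τ => by simp only [ContinuousMap.coe_mk, hΘ, hS, hT]) 0 1
  -- At `τ = 1` the logarithm extends over the whole square, so its increment around the closed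
  -- boundary vanishes.
  have hone : Θ (1, 1) - Θ (1, 0) = Φ (S 1, T 1) - Φ (S 0, T 0) :=
    log_sub_log_eq ⟨fun r => Θ (1, r), by fun_prop⟩ ⟨fun r => Φ (S r, T r), by fun_prop⟩
      (fun r => by simp only [ContinuousMap.coe_mk, hΘ, hΦ]) 1 0
  rw [hS, hT, sub_self] at hone
  have hzero : IsWindingNumber (differenceLoop α β) 0 := by
    refine ⟨⟨fun r => Θ (0, r), by fun_prop⟩, fun r => (h0 r).symm, ?_⟩
    simp only [ContinuousMap.coe_mk, Int.cast_zero, zero_mul]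
    linear_combination hends + hone
  exact (isWindingNumber_windingNumber _ fun r => h0 r ▸ Complex.exp_ne_zero _).unique hzero

/-! ### Paths in the disk -/

theorem IsClosedTopologicalDisk.isCompact {D : Set ℂ} (hD : IsClosedTopologicalDisk D) :
    IsCompact D := by
  obtain ⟨h⟩ := hD
  have : CompactSpace (closedBall (0 : ℂ) 1) :=
    isCompact_iff_compactSpace.1 (isCompact_closedBall 0 1)
  exact isCompact_iff_compactSpace.2 h.symm.compactSpace

/-- Straight-line interpolation in the round disk, transported to `D`. Being constant on the
diagonal, it moves nearby endpoints only slightly. -/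
theorem IsClosedTopologicalDisk.exists_interpolation {D : Set ℂ} (hD : IsClosedTopologicalDisk D) :
    ∃ M : C(I × D × D, D), (∀ x y, M (0, x, y) = x) ∧ (∀ x y, M (1, x, y) = y) ∧
      ∀ τ x, M (τ, x, x) = x := by
  obtain ⟨h⟩ := hD
  have hmem : ∀ p : I × D × D,
      (1 - (p.1 : ℝ)) • (h p.2.1 : ℂ) + (p.1 : ℝ) • (h p.2.2 : ℂ) ∈ closedBall (0 : ℂ) 1 :=
    fun p => convex_closedBall 0 1 (h p.2.1).2 (h p.2.2).2 (sub_nonneg.2 p.1.2.2) p.1.2.1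
      (by ring)
  refine ⟨⟨fun p => h.symm ⟨_, hmem p⟩, by fun_prop⟩, fun x y => ?_, fun x y => ?_,
    fun τ x => ?_⟩
  · exact h.symm_apply_eq.2 (Subtype.ext (by simp))
  · exact h.symm_apply_eq.2 (Subtype.ext (by simp))
  · exact h.symm_apply_eq.2 (Subtype.ext (by
      change (1 - (τ : ℝ)) • (h x : ℂ) + (τ : ℝ) • (h x : ℂ) = h x
      rw [← add_smul, sub_add_cancel, one_smul]))

theorem exists_path_lift {z : ℂ} (hz : z ≠ 0) {D : Set ℂ} {u : List Letter} {p p' : ℂ}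
    (α : Path p p') (hα : range α ⊆ wordMap z u '' D) :
    ∃ a : C(I, D), ∀ s, wordMap z u (a s) = α s := by
  have hn : z ^ u.length ≠ 0 := pow_ne_zero _ hz
  have hlift : ∀ s, (α s - wordMap z u 0) / z ^ u.length ∈ D := fun s => by
    obtain ⟨x, hx, hxs⟩ := hα ⟨s, rfl⟩
    rwa [← hxs, wordMap_eq z u x, add_sub_cancel_right, mul_div_cancel_left₀ _ hn]
  refine ⟨⟨fun s => ⟨_, hlift s⟩, by fun_prop⟩, fun s => ?_⟩
  rw [wordMap_eq]
  change z ^ u.length * ((α s - wordMap z u 0) / z ^ u.length) + _ = _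
  rw [mul_div_cancel₀ _ hn, sub_add_cancel]

theorem wordMap_injective {z : ℂ} (hz : z ≠ 0) (u : List Letter) :
    Function.Injective (wordMap z u) := fun x y h => by
  have := wordMap_sub z u x y
  rw [h, sub_self, eq_comm, mul_eq_zero] at this
  exact sub_eq_zero.1 (this.resolve_left (pow_ne_zero _ hz))

/-- At `z' = z`, `x' = x` the deformation is stationary and the claim is `hx`; compactness of `I ×
D` makes the neighborhood uniform in `τ` and `y`. -/
theorem eventually_wordMap_interpolation_ne {z : ℂ} {D : Set ℂ} (hD : IsCompact D)
    (M : C(I × D × D, D)) (hM : ∀ τ x, M (τ, x, x) = x) (u v : List Letter) (x : D)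
    (hx : wordMap z u x ∉ wordMap z v '' D) :
    ∃ ρ > 0, ∀ (z' : ℂ) (x' : D), dist z' z < ρ → dist x' x < ρ → ∀ (τ : I) (y : D),
      wordMap (z + τ * (z' - z)) u (M (τ, x, x')) ≠ wordMap (z + τ * (z' - z)) v y := by
  have : CompactSpace D := isCompact_iff_compactSpace.1 hD
  have hev : ∀ᶠ q : ℂ × D in 𝓝 (z, x), ∀ w ∈ (univ : Set (I × D)),
      wordMap (z + w.1 * (q.1 - z)) u (M (w.1, x, q.2)) ≠
        wordMap (z + w.1 * (q.1 - z)) v w.2 := by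
    refine isCompact_univ.eventually_forall_of_forall_eventually fun w _ => ?_
    have hl : Continuous fun q : (ℂ × D) × I × D =>
        wordMap (z + q.2.1 * (q.1.1 - z)) u (M (q.2.1, x, q.1.2)) :=
      (continuous_wordMap u).comp (f := fun q : (ℂ × D) × I × D =>
        (z + q.2.1 * (q.1.1 - z), (M (q.2.1, x, q.1.2) : ℂ))) (by fun_prop)
    have hr : Continuous fun q : (ℂ × D) × I × D =>
        wordMap (z + q.2.1 * (q.1.1 - z)) v q.2.2 :=
      (continuous_wordMap v).comp (f := fun q : (ℂ × D) × I × D =>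
        (z + q.2.1 * (q.1.1 - z), (q.2.2 : ℂ))) (by fun_prop)
    refine (isOpen_ne_fun hl hr).mem_nhds ?_
    simp only [mem_ofPred_eq, sub_self, mul_zero, add_zero, hM]
    exact fun h => hx ⟨w.2, w.2.2, h.symm⟩
  obtain ⟨ρ, hρ, h⟩ := Metric.eventually_nhds_iff.1 hev
  exact ⟨ρ, hρ, fun z' x' hz hx τ y =>
    h (y := (z', x')) (Prod.dist_eq.trans_lt (max_lt hz hx)) (τ, y) (mem_univ _)⟩

/-- The crossing condition of a trap forces paths in the disk with nearby endpoints to have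
intersecting images, also for nearby parameters. -/
theorem IsTrap.exists_crossing {z : ℂ} (hz : z ≠ 0) {D : Set ℂ} {u v : List Letter}
    (htrap : IsTrap z D u v) :
    ∃ a₀ ∈ limitSet z, ∃ a₁ ∈ limitSet z, ∃ b₀ ∈ limitSet z, ∃ b₁ ∈ limitSet z, ∃ ρ > 0,
      ∀ z', dist z' z < ρ → ∀ a b : C(I, D), dist (a 0 : ℂ) a₀ < ρ → dist (a 1 : ℂ) a₁ < ρ →
        dist (b 0 : ℂ) b₀ < ρ → dist (b 1 : ℂ) b₁ < ρ →
        ∃ s t, wordMap z' u (a s) = wordMap z' v (b t) := by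
  obtain ⟨-, ⟨⟨a₀, ha₀, rfl⟩, hpm⟩, -, ⟨⟨a₁, ha₁, rfl⟩, hpp⟩, -, ⟨⟨b₀, hb₀, rfl⟩, hqm⟩,
    -, ⟨⟨b₁, hb₁, rfl⟩, hqp⟩, α, β, hα, hβ, hne⟩ := htrap.crossing
  obtain ⟨M, hM0, hM1, hM⟩ := htrap.isDisk.exists_interpolation
  have hD := htrap.isDisk.isCompact
  obtain ⟨a, ha⟩ := exists_path_lift hz α hα
  obtain ⟨b, hb⟩ := exists_path_lift hz β hβ
  have e₀ : (a 0 : ℂ) = a₀ := wordMap_injective hz u ((ha 0).trans α.source)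
  have e₁ : (a 1 : ℂ) = a₁ := wordMap_injective hz u ((ha 1).trans α.target)
  have e₂ : (b 0 : ℂ) = b₀ := wordMap_injective hz v ((hb 0).trans β.source)
  have e₃ : (b 1 : ℂ) = b₁ := wordMap_injective hz v ((hb 1).trans β.target)
  obtain ⟨ρ₀, h₀, hρ₀⟩ := eventually_wordMap_interpolation_ne hD M hM u v (a 0) (e₀ ▸ hpm)
  obtain ⟨ρ₁, h₁, hρ₁⟩ := eventually_wordMap_interpolation_ne hD M hM u v (a 1) (e₁ ▸ hpp)
  obtain ⟨ρ₂, h₂, hρ₂⟩ := eventually_wordMap_interpolation_ne hD M hM v u (b 0) (e₂ ▸ hqm)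
  obtain ⟨ρ₃, h₃, hρ₃⟩ := eventually_wordMap_interpolation_ne hD M hM v u (b 1) (e₃ ▸ hqp)
  refine ⟨a₀, ha₀, a₁, ha₁, b₀, hb₀, b₁, hb₁, min (min ρ₀ ρ₁) (min ρ₂ ρ₃),
    lt_min (lt_min h₀ h₁) (lt_min h₂ h₃), fun z' hz' a' b' d₀ d₁ d₂ d₃ => ?_⟩
  simp only [lt_min_iff] at hz' d₀ d₁ d₂ d₃
  rw [← e₀] at d₀
  rw [← e₁] at d₁
  rw [← e₂] at d₂
  rw [← e₃] at d₃
  by_contra! hdisj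
  -- Parameter and paths are deformed together: `z` moves straight to `z'` while `M` carries the
  -- trap's paths to the new ones inside `D`.
  refine hne (algebraicIntersectionNumber_eq_zero
    ⟨fun q => wordMap (z + q.1 * (z' - z)) u (M (q.1, a q.2, a' q.2)),
      (continuous_wordMap u).comp (f := fun q : I × I =>
        (z + q.1 * (z' - z), (M (q.1, a q.2, a' q.2) : ℂ))) (by fun_prop)⟩
    ⟨fun q => wordMap (z + q.1 * (z' - z)) v (M (q.1, b q.2, b' q.2)),
      (continuous_wordMap v).comp (f := fun q : I × I =>
        (z + q.1 * (z' - z), (M (q.1, b q.2, b' q.2) : ℂ))) (by fun_prop)⟩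
    (fun s => by simp [hM0, ha]) (fun t => by simp [hM0, hb]) ?_
    (fun s t => by simpa [hM1] using hdisj s t))
  rintro τ s t (rfl | rfl | rfl | rfl)
  · exact hρ₀ z' (a' 0) hz'.1.1 d₀.1.1 τ _
  · exact hρ₁ z' (a' 1) hz'.1.2 d₁.1.2 τ _
  · exact (hρ₂ z' (b' 0) hz'.2.1 d₂.2.1 τ _).symm
  · exact (hρ₃ z' (b' 1) hz'.2.2 d₃.2.2 τ _).symm

/-! ### Traps -/

theorem wordMap_cons_mem_gen_image {z : ℂ} (hz : ‖z‖ < 1) (a : Letter) (u : List Letter) {x : ℂ}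
    (hx : x ∈ limitSet z) : wordMap z (a :: u) x ∈ gen z a '' limitSet z :=
  ⟨_, wordMap_mem (fun b _ => gen_mem_limitSet hz b) u hx, rfl⟩

theorem JoinedIn.exists_continuousMap {E D : Set ℂ} {x y : ℂ} (h : JoinedIn E x y) (hE : E ⊆ D) :
    ∃ a : C(I, D), (a 0 : ℂ) = x ∧ (a 1 : ℂ) = y ∧ ∀ s, (a s : ℂ) ∈ E := by
  obtain ⟨γ, hγ⟩ := h
  exact ⟨⟨fun s => ⟨γ s, hE (hγ s)⟩, by fun_prop⟩, γ.source, γ.target, hγ⟩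

/-- If `fΛ_z` and `gΛ_z` are so close to each other that short hops in `Λ_z` stay in `D`, and paths
in `D` between certain points of `Λ_z` have intersecting images under `u` and `v`, then `fΛ_z`
and `gΛ_z` intersect. -/
theorem gen_image_inter_nonempty {z : ℂ} (hz : ‖z‖ < 1) {D : Set ℂ} {u v : List Letter}
    {a₀ a₁ b₀ b₁ : ℂ} (ha₀ : a₀ ∈ limitSet z) (ha₁ : a₁ ∈ limitSet z) (hb₀ : b₀ ∈ limitSet z)
    (hb₁ : b₁ ∈ limitSet z)
    (hcross : ∀ a b : C(I, D), (a 0 : ℂ) = a₀ → (a 1 : ℂ) = a₁ → (b 0 : ℂ) = b₀ →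
      (b 1 : ℂ) = b₁ → ∃ s t, wordMap z (Letter.f :: u) (a s) = wordMap z (Letter.g :: v) (b t))
    {r : ℝ} (hr : cthickening r (limitSet z) ⊆ D) {p q : ℂ}
    (hp : p ∈ gen z Letter.f '' limitSet z) (hq : q ∈ gen z Letter.g '' limitSet z)
    (hpq : dist p q ≤ 2 * r) :
    (gen z Letter.f '' limitSet z ∩ gen z Letter.g '' limitSet z).Nonempty := by
  obtain ⟨⟨p₀, q₀⟩, ⟨hp₀, hq₀⟩, hmin⟩ :=
    ((isCompact_gen_image_limitSet hz Letter.f).prod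
      (isCompact_gen_image_limitSet hz Letter.g)).exists_isMinOn ⟨(p, q), hp, hq⟩
      continuous_dist.continuousOn
  have hmin' : ∀ x ∈ gen z Letter.f '' limitSet z, ∀ y ∈ gen z Letter.g '' limitSet z,
      dist p₀ q₀ ≤ dist x y := fun x hx y hy => hmin (show (x, y) ∈ _ from ⟨hx, hy⟩)
  rcases (dist_nonneg (x := p₀) (y := q₀)).eq_or_lt with h0 | hpos
  · exact ⟨p₀, hp₀, dist_eq_zero.1 h0.symm ▸ hq₀⟩
  exfalso
  have hsub : cthickening (dist p₀ q₀ / 2) (limitSet z) ⊆ D :=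
    (cthickening_mono (by linarith [hmin' p hp q hq]) _).trans hr
  have hjoin := fun {x y : ℂ} => joinedIn_cthickening_half hz hpos hp₀ hq₀ le_rfl (x := x) (y := y)
  obtain ⟨a, ha0, ha1, ha⟩ := JoinedIn.exists_continuousMap (hjoin ha₀ ha₁) hsub
  obtain ⟨b, hb0, hb1, hb⟩ := JoinedIn.exists_continuousMap (hjoin hb₀ hb₁) hsub
  obtain ⟨s, t, hst⟩ := hcross a b ha0 ha1 hb0 hb1
  obtain ⟨x, hx, hax⟩ := exists_dist_le_of_mem_cthickening hz (half_pos hpos).le (ha s)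
  obtain ⟨y, hy, hby⟩ := exists_dist_le_of_mem_cthickening hz (half_pos hpos).le (hb t)
  -- A nonempty word contracts by at least one factor `‖z‖`, which gives the strict inequality
  -- against minimality.
  have hshrink : ∀ (c : Letter) (w : List Letter) (x y : ℂ), dist x y ≤ dist p₀ q₀ / 2 →
      dist (wordMap z (c :: w) x) (wordMap z (c :: w) y) ≤ ‖z‖ * (dist p₀ q₀ / 2) := by
    intro c w x y hxy
    rw [dist_wordMap]
    gcongr
    exact pow_le_of_le_one (norm_nonneg z) hz.le (by simp)
  have h1 := hshrink Letter.f u _ _ hax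
  have h2 := hshrink Letter.g v _ _ hby
  rw [hst] at h1
  have h3 := hmin' _ (wordMap_cons_mem_gen_image hz Letter.f u hx)
    _ (wordMap_cons_mem_gen_image hz Letter.g v hy)
  have h4 := dist_triangle_left (wordMap z (Letter.f :: u) x) (wordMap z (Letter.g :: v) y)
    (wordMap z (Letter.g :: v) (b t))
  have h5 := mul_lt_of_lt_one_left hpos hz
  linarith

theorem IsTrap.gen_image_inter_nonempty {z : ℂ} (hz : z ≠ 0) (hz1 : ‖z‖ < 1) {D : Set ℂ}
    {u v : List Letter} (htrap : IsTrap z D u v) :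
    (gen z Letter.f '' limitSet z ∩ gen z Letter.g '' limitSet z).Nonempty := by
  obtain ⟨a₀, ha₀, a₁, ha₁, b₀, hb₀, b₁, hb₁, ρ, hρ, hcross⟩ := htrap.exists_crossing hz
  obtain ⟨u, rfl⟩ := htrap.left_start
  obtain ⟨v, rfl⟩ := htrap.right_start
  obtain ⟨ε, hε, hsub, p, hp, q, hq, hpq⟩ := htrap.close
  have hr : cthickening (ε / 2) (limitSet z) ⊆ D := by
    rw [← closure_thickening (half_pos hε)]
    exact closure_minimal hsub htrap.isDisk.isCompact.isClosed
  exact IFSTraps.gen_image_inter_nonempty hz1 ha₀ ha₁ hb₀ hb₁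
    (fun a b h₀ h₁ h₂ h₃ => hcross z (by simpa) a b (by simpa [h₀]) (by simpa [h₁])
      (by simpa [h₂]) (by simpa [h₃])) hr hp hq (by linarith)

theorem IsTrap.eventually_gen_image_inter_nonempty {z : ℂ} (hz : z ≠ 0) (hz1 : ‖z‖ < 1)
    {D : Set ℂ} {u v : List Letter} (htrap : IsTrap z D u v) :
    ∀ᶠ z' in 𝓝 z, (gen z' Letter.f '' limitSet z' ∩ gen z' Letter.g '' limitSet z').Nonempty := by
  obtain ⟨p, ⟨x, hx, hxp⟩, ⟨y, hy, hyp⟩⟩ := htrap.gen_image_inter_nonempty hz hz1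
  obtain ⟨a₀, ha₀, a₁, ha₁, b₀, hb₀, b₁, hb₁, ρ, hρ, hcross⟩ := htrap.exists_crossing hz
  obtain ⟨u, rfl⟩ := htrap.left_start
  obtain ⟨v, rfl⟩ := htrap.right_start
  -- Half of `η` absorbs the motion of the limit set, the other half the paths around it; `ε` plays
  -- no further role, as the distance at `z'` is small by the common point at `z`.
  obtain ⟨η, hη, hηD⟩ := (isCompact_limitSet hz1).exists_cthickening_subset_open isOpen_interior
    htrap.limitSet_subset
  have hclose : ∀ᶠ w : ℂ × ℂ × ℂ in 𝓝 (z, x, y),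
      dist (gen w.1 Letter.f w.2.1) (gen w.1 Letter.g w.2.2) < η := by
    have hcont : Continuous fun w : ℂ × ℂ × ℂ =>
        dist (gen w.1 Letter.f w.2.1) (gen w.1 Letter.g w.2.2) := by
      simp only [gen]
      fun_prop
    exact hcont.continuousAt.eventually_lt_const (by simpa only [hxp, hyp, dist_self] using hη)
  obtain ⟨κ, hκ, hclose⟩ := Metric.eventually_nhds_iff.1 hclose
  have hlt : ∀ᶠ z' : ℂ in 𝓝 z, ‖z'‖ < 1 := continuous_norm.continuousAt.eventually_lt_const hz1
  filter_upwards [hlt, ball_mem_nhds z hρ, ball_mem_nhds z hκ,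
    eventually_limitSet_subset_cthickening hz1 (half_pos hη),
    eventually_exists_dist_limitSet_lt hz1 hx hκ, eventually_exists_dist_limitSet_lt hz1 hy hκ,
    eventually_exists_dist_limitSet_lt hz1 ha₀ hρ, eventually_exists_dist_limitSet_lt hz1 ha₁ hρ,
    eventually_exists_dist_limitSet_lt hz1 hb₀ hρ, eventually_exists_dist_limitSet_lt hz1 hb₁ hρ]
    with z' hz1' hzρ hzκ hsub hx' hy' ha₀' ha₁' hb₀' hb₁'
  obtain ⟨x', hx', hxd⟩ := hx'
  obtain ⟨y', hy', hyd⟩ := hy'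
  obtain ⟨a₀', ha₀', ha₀d⟩ := ha₀'
  obtain ⟨a₁', ha₁', ha₁d⟩ := ha₁'
  obtain ⟨b₀', hb₀', hb₀d⟩ := hb₀'
  obtain ⟨b₁', hb₁', hb₁d⟩ := hb₁'
  have hr : cthickening (η / 2) (limitSet z') ⊆ D := by
    refine (cthickening_subset_of_subset _ hsub).trans
      ((cthickening_cthickening_subset (half_pos hη).le (half_pos hη).le _).trans ?_)
    rw [add_halves]
    exact hηD.trans interior_subset
  refine IFSTraps.gen_image_inter_nonempty hz1' ha₀' ha₁' hb₀' hb₁'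
    (fun a b h₀ h₁ h₂ h₃ => hcross z' hzρ a b (by rwa [h₀]) (by rwa [h₁])
      (by rwa [h₂]) (by rwa [h₃])) hr (mem_image_of_mem _ hx') (mem_image_of_mem _ hy') ?_
  have := hclose (y := (z', x', y'))
    (Prod.dist_eq.trans_lt (max_lt hzκ (Prod.dist_eq.trans_lt (max_lt hxd hyd))))
  exact this.le.trans (by linarith)

end IFSTraps

theorem mainTheorem7 (z : ℂ) (hz_pos : 0 < ‖z‖) (hz_lt : ‖z‖ < 1)
    (D : Set ℂ) (u v : List IFSTraps.Letter) (htrap : IFSTraps.IsTrap z D u v) :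
    z ∈ interior IFSTraps.connectednessLocus := by
  rw [mem_interior_iff_mem_nhds]
  filter_upwards [htrap.eventually_gen_image_inter_nonempty (norm_pos_iff.1 hz_pos) hz_lt,
    continuous_norm.continuousAt.eventually_lt_const hz_lt,
    continuous_norm.continuousAt.eventually_const_lt hz_pos] with z' ⟨p, hf, hg⟩ hlt hpos
  exact ⟨hpos, hlt, IFSTraps.isConnected_limitSet hlt hf hg⟩
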